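/- Let $k$ be a field, let $n,m\ge 0$ be integers, and let $R=k[X]=k[X_0,\dots,X_n]$ and $k[Y]=k[Y_0,\dots,Y_m]$ be standard graded polynomial rings. Let $\mathfrak F:\mathbb P^n\dashrightarrow\mathbb P^m$ be a rational map, given by an $(m+1)$-tuple $\mathbf f=(f_0,\dots,f_m)$ of forms of $R$, not all zero, of the same degree $d\ge 1$. Let $W\subset\mathbb P^m$ be its image, i.e. the projective variety with homogeneous ideal $I(W)=\ker(k[Y]\to R,\ Y_j\mapsto f_j)$, and let $S=k[Y]/I(W)\simeq k[\mathbf f]$ be its homogeneous coordinate ring. Let $$\mathcal J=\ker\bigl(R[Y]\to \mathcal R_R((\mathbf f))=R[(\mathbf f)t],\quad Y_j\mapsto f_jt\bigr)$$ be the presentation ideal of the Rees algebra of the ideal $(\mathbf f)\subset R$, a bihomogeneous ideal of $k[X,Y]$, and let $\mathcal J_{1,*}=\bigoplus_{q\ge 0}\mathcal J_{1,q}$, where $\mathcal J_{1,q}$ is the space of forms in $\mathcal J$ of degree $1$ in $X$ and degree $q$ in $Y$. If the ideal generated by (the image of) $\mathcal J_{1,*}$ in the ring $S[X]=(k[Y]/I(W))[X]$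 has codimension (height) at least $n$, then $\mathfrak F$ is birational onto $W$; that is, there are forms $g_0,\dots,g_n\in S$, not all zero, of the same degree $e\ge 1$, and nonzero homogeneous $F,F'\in R$ such that $F X_i=F' g_i(f_0,\dots,f_m)$ in $R$ for all $i=0,\dots,n$. -/

import Mathlib

namespace RatMap

open MvPolynomial

noncomputable section

/-- Let `R` be a `k`-algebra graded by the submodules `𝒜 e`. The tuple `f` is a rational datum of
degree `d` on `R`: its members are forms of the same degree `d ≥ 1`, the ring `R` is torsion-free
over the subalgebra `k[f]`, and the ideal `(f)` lies in no minimal prime of `R`. -/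
structure IsRationalDatum {k R ι : Type*} [Field k] [CommRing R] [Algebra k R]
    (𝒜 : ℕ → Submodule k R) (d : ℕ) (f : ι → R) : Prop where
  one_le_degree : 1 ≤ d
  mem_degree : ∀ j, f j ∈ 𝒜 d
  torsionFree : Module.IsTorsionFree (Algebra.adjoin k (Set.range f)) R
  not_le_minimalPrime : ∀ P ∈ minimalPrimes R, ¬ Ideal.span (Set.range f) ≤ P

/-- Two tuples of forms are equivalent (represent the same rational map): they are proportional
by a quotient of two regular homogeneous elements of `R`. -/
def Equivalent {k R ι : Type*} [Field k] [CommRing R] [Algebra k R]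
    (𝒜 : ℕ → Submodule k R) (f f' : ι → R) : Prop :=
  ∃ F ∈ nonZeroDivisors R, ∃ F' ∈ nonZeroDivisors R,
    SetLike.IsHomogeneousElem 𝒜 F ∧ SetLike.IsHomogeneousElem 𝒜 F' ∧
      ∀ j, F * f' j = F' * f j

section Source

variable {k : Type*} [Field k] {n m : ℕ}

/-- The ideal `I(W)` of the image `W ⊆ ℙᵐ` of the rational map given by `f`: all polynomial
relations over `k` among the `f j`. -/
def imageIdeal (f : Fin (m + 1) → MvPolynomial (Fin (n + 1)) k) :
    Ideal (MvPolynomial (Fin (m + 1)) k) :=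
  RingHom.ker (aeval f : MvPolynomial (Fin (m + 1)) k →ₐ[k] MvPolynomial (Fin (n + 1)) k)

/-- The homogeneous coordinate ring `S = k[Y] / I(W)` of the image. -/
abbrev ImageRing (f : Fin (m + 1) → MvPolynomial (Fin (n + 1)) k) : Type _ :=
  MvPolynomial (Fin (m + 1)) k ⧸ imageIdeal f

/-- The standard grading of `S = k[Y] / I(W)`: the degree `e` piece consists of the residues of
the forms of degree `e`. -/
def imageGrading (f : Fin (m + 1) → MvPolynomial (Fin (n + 1)) k) (e : ℕ) :
    Submodule k (ImageRing f) :=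
  (homogeneousSubmodule (Fin (m + 1)) k e).map
    (Ideal.Quotient.mkₐ k (imageIdeal f)).toLinearMap

/-- The map `S → k[X]`, `g ↦ g(f)`, which identifies `S` with `k[f]`. -/
def substitute (f : Fin (m + 1) → MvPolynomial (Fin (n + 1)) k) :
    ImageRing f →ₐ[k] MvPolynomial (Fin (n + 1)) k :=
  Ideal.kerLiftAlg
    (aeval f : MvPolynomial (Fin (m + 1)) k →ₐ[k] MvPolynomial (Fin (n + 1)) k)

/-- The rational map `ℙⁿ ⇢ ℙᵐ` given by `f` is birational onto its image: there is a rational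
datum `g = (g₀, …, gₙ)` on `S` such that `g(f)` is equivalent to the identity `(X₀, …, Xₙ)`. -/
def IsBirationalOntoImage (f : Fin (m + 1) → MvPolynomial (Fin (n + 1)) k) : Prop :=
  ∃ (e : ℕ) (g : Fin (n + 1) → ImageRing f), IsRationalDatum (imageGrading f) e g ∧
    Equivalent (homogeneousSubmodule (Fin (n + 1)) k) (fun i => substitute f (g i)) X

/-- The surjection `R[Y] → R[(f)t]`, `Y j ↦ f j * t`, onto the Rees algebra of the ideal `(f)` of
`R = k[X]`. -/
def reesPresentation (f : Fin (m + 1) → MvPolynomial (Fin (n + 1)) k) :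
    MvPolynomial (Fin (m + 1)) (MvPolynomial (Fin (n + 1)) k)
      →ₐ[MvPolynomial (Fin (n + 1)) k] reesAlgebra (Ideal.span (Set.range f)) :=
  aeval fun j => ⟨Polynomial.monomial 1 (f j), reesAlgebra.monomial_mem.mpr (by
    simpa using Ideal.subset_span (Set.mem_range_self j))⟩

/-- The presentation ideal `𝒥` of the Rees algebra. -/
def reesIdeal (f : Fin (m + 1) → MvPolynomial (Fin (n + 1)) k) :
    Ideal (MvPolynomial (Fin (m + 1)) (MvPolynomial (Fin (n + 1)) k)) :=
  RingHom.ker (reesPresentation f)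

/-- The set `𝒥_{(p,q)}` of forms in `𝒥` of bidegree `(p, q)`: homogeneous of degree `p` in `X` and
of degree `q` in `Y`. -/
def reesPiece (f : Fin (m + 1) → MvPolynomial (Fin (n + 1)) k) (p q : ℕ) :
    Set (MvPolynomial (Fin (m + 1)) (MvPolynomial (Fin (n + 1)) k)) :=
  {P | P ∈ reesIdeal f ∧ P.IsHomogeneous q ∧ ∀ α, (P.coeff α).IsHomogeneous p}

/-- The ideal `(𝒥_{1,*})` of `k[X][Y]`, generated by all forms in `𝒥` of bidegree `(1, q)`,
`q ≥ 0`. -/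
def semilinearIdeal (f : Fin (m + 1) → MvPolynomial (Fin (n + 1)) k) :
    Ideal (MvPolynomial (Fin (m + 1)) (MvPolynomial (Fin (n + 1)) k)) :=
  Ideal.span (⋃ q : ℕ, reesPiece f 1 q)

/-- The natural surjection `k[X][Y] → S[X]`, where `S = k[Y] / I(W)`. -/
def toImageRing (f : Fin (m + 1) → MvPolynomial (Fin (n + 1)) k) :
    MvPolynomial (Fin (m + 1)) (MvPolynomial (Fin (n + 1)) k) →+*
      MvPolynomial (Fin (n + 1)) (ImageRing f) :=
  eval₂Hom (MvPolynomial.map (algebraMap k (ImageRing f)))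
    fun j => C (Ideal.Quotient.mk (imageIdeal f) (X j))

/-- The ideal generated by `𝒥_{1,*}` in `(k[Y] / I(W))[X]`. -/
def semilinearIdealOverImage (f : Fin (m + 1) → MvPolynomial (Fin (n + 1)) k) :
    Ideal (MvPolynomial (Fin (n + 1)) (ImageRing f)) :=
  (semilinearIdeal f).map (toImageRing f)

end Source

end

end RatMap

/-! A form of bidegree `(1, q)` in the Rees ideal is a relation `∑ bᵢ(Y) Xᵢ` that vanishes under `Y
↦ f`, so it is a linear equation over `S` satisfied by the vector `(X₀, …, Xₙ)`. The height of the
ideal of `S[X]` generated by such linear forms is at most their rank over `Frac S`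
(`height_span_linearForm_le`), so the hypothesis provides `n` independent equations. The solutions
of such a system in `n + 1` unknowns form a line, spanned by the signed maximal minors. After `Y ↦
f` these minors are therefore proportional to the variables (`mul_signedMinors_comm`), and
independence keeps them from all vanishing (`exists_signedMinors_ne_zero`). Being forms in `Y`, they
define the inverse map. -/

namespace RatMap

open MvPolynomial

section LinearForms

/-- The linear form with coefficient vector `a`. -/
noncomputable def linearForm {S σ : Type*} [CommRing S] [Fintype σ] :
    (σ → S) →ₗ[S] MvPolynomial σ S :=
  Fintype.linearCombination S X

lemma linearForm_apply {S σ : Type*} [CommRing S] [Fintype σ] (a : σ → S) :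
    linearForm a = ∑ i, C (a i) * X i := by
  simp [linearForm, Fintype.linearCombination_apply, smul_eq_C_mul]

lemma map_linearForm {S T σ : Type*} [CommRing S] [CommRing T] [Fintype σ] (φ : S →+* T)
    (a : σ → S) : MvPolynomial.map φ (linearForm a) = linearForm (fun i => φ (a i)) := by
  simp [linearForm_apply]

/-- Over a field, the ideal generated by a family of `r` linear forms is contained in a prime of
height at most `r`. -/
lemma exists_prime_height_le_of_linearForms {K σ : Type*} [Field K] [Fintype σ] {r : ℕ}
    (v : Fin r → σ → K) :
    ∃ Q : Ideal (MvPolynomial σ K), Q.IsPrime ∧ (∀ i, linearForm (v i) ∈ Q) ∧ Q.height ≤ r := by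
  classical
  set J : Ideal (MvPolynomial σ K) := Ideal.span (Set.range fun i => linearForm (v i)) with hJ
  -- Linear forms have no constant term, so the ideal is proper and has a minimal prime, to which
  -- Krull's height theorem applies.
  have hJle : J ≤ RingHom.ker (constantCoeff : MvPolynomial σ K →+* K) := by
    rw [hJ, Ideal.span_le]
    rintro _ ⟨i, rfl⟩
    simp [RingHom.mem_ker, linearForm_apply]
  have hprime : (RingHom.ker (constantCoeff : MvPolynomial σ K →+* K)).IsPrime :=
    RingHom.ker_isPrime _
  obtain ⟨Q, hQ, -⟩ := Ideal.exists_minimalPrimes_le hJle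
  refine ⟨Q, hQ.1.1, fun i => hQ.1.2 (Ideal.subset_span ⟨i, rfl⟩), ?_⟩
  have hfin : J = Ideal.span
      ((Finset.univ.image fun i => linearForm (v i) : Finset (MvPolynomial σ K)) : Set _) := by
    simp [hJ]
  rw [hfin] at hQ
  refine (Ideal.height_le_card_of_mem_minimalPrimes_span_finset hQ).trans ?_
  exact_mod_cast Finset.card_image_le.trans_eq (by simp)

attribute [local instance] MvPolynomial.algebraMvPolynomial in
/-- The height of an ideal of `S[X]` generated by linear forms is at most the rank of the system
of these linear forms over the fraction field of `S`. -/
lemma height_span_linearForm_le {S σ : Type*} [CommRing S] [IsDomain S] [Fintype σ]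
    (A : Set (σ → S)) :
    (Ideal.span (linearForm '' A)).height ≤
      Module.finrank (FractionRing S) (Submodule.span (FractionRing S)
        ((fun a i => algebraMap S (FractionRing S) (a i)) '' A)) := by
  set K := FractionRing S
  set B : Set (σ → K) := (fun a i => algebraMap S K (a i)) '' A
  obtain ⟨v, -, hspan, -⟩ := Submodule.exists_fun_fin_finrank_span_eq K B
  obtain ⟨Q, hQ, hvQ, hht⟩ := exists_prime_height_le_of_linearForms v
  have hBQ : Submodule.span K B ≤ (Q.restrictScalars K).comap linearForm := by
    rw [← hspan, Submodule.span_le]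
    rintro _ ⟨i, rfl⟩
    exact hvQ i
  refine (Ideal.height_mono (J := Q.under (MvPolynomial σ S)) ?_).trans ?_
  · rw [Ideal.span_le]
    rintro _ ⟨a, ha, rfl⟩
    change MvPolynomial.map (algebraMap S K) (linearForm a) ∈ Q
    rw [map_linearForm]
    exact hBQ (Submodule.subset_span ⟨a, ha, rfl⟩)
  -- `K[X]` is the localization of `S[X]` at the nonzero constants, so contracting a prime preserves
  -- its height.
  · rw [IsLocalization.height_under ((nonZeroDivisors S).map (C (σ := σ)))]
    exact hht

end LinearForms

section Determinants

/-- The functional `v ↦ det (v; A)` evaluated at the standard basis: the signed maximal minors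
of an `n × (n + 1)` matrix. -/
noncomputable def signedMinors {S : Type*} [CommRing S] {n : ℕ} (A : Fin n → Fin (n + 1) → S)
    (j : Fin (n + 1)) : S :=
  Matrix.det (Matrix.of (Fin.cons (Pi.single j 1) A : Fin (n + 1) → Fin (n + 1) → S))

lemma det_cons_eq_sum {S : Type*} [CommRing S] {n : ℕ} (A : Fin n → Fin (n + 1) → S)
    (v : Fin (n + 1) → S) :
    Matrix.det (Matrix.of (Fin.cons v A : Fin (n + 1) → Fin (n + 1) → S)) =
      ∑ j, v j * signedMinors A j := by
  have hcons (w : Fin (n + 1) → S) :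
      Matrix.det (Matrix.of (Fin.cons w A : Fin (n + 1) → Fin (n + 1) → S)) =
        (Matrix.detRowAlternating (R := S)).toMultilinearMap.toLinearMap
          (Fin.cons 0 A : Fin (n + 1) → Fin (n + 1) → S) 0 w := by
    rw [MultilinearMap.toLinearMap_apply, Fin.update_cons_zero]
    rfl
  simp_rw [signedMinors, hcons]
  conv_lhs => rw [pi_eq_sum_univ' v, map_sum]
  simp only [map_smul, smul_eq_mul]

lemma map_signedMinors {S T : Type*} [CommRing S] [CommRing T] {n : ℕ} (φ : S →+* T)
    (A : Fin n → Fin (n + 1) → S) (j : Fin (n + 1)) :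
    φ (signedMinors A j) = signedMinors (fun i l => φ (A i l)) j := by
  rw [signedMinors, signedMinors, RingHom.map_det]
  congr 1
  ext i l
  refine Fin.cases ?_ (fun i => ?_) i
  · by_cases h : l = j <;> simp [h]
  · simp

/-- The signed maximal minors are proportional to each solution of the linear system. -/
lemma mul_signedMinors_comm {S : Type*} [CommRing S] [IsDomain S] {n : ℕ}
    (A : Fin n → Fin (n + 1) → S) {x : Fin (n + 1) → S} (hx : x ≠ 0)
    (hA : ∀ i, ∑ l, A i l * x l = 0) (i j : Fin (n + 1)) :
    x i * signedMinors A j = x j * signedMinors A i := by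
  -- The added row `xᵢ eⱼ - xⱼ eᵢ` also annihilates `x`, so the square matrix is singular.
  have h := det_cons_eq_sum A (x i • Pi.single j 1 - x j • Pi.single i 1)
  rw [Matrix.exists_mulVec_eq_zero_iff.mp ⟨x, hx, ?_⟩] at h
  · have h' : ∑ l, (x i • Pi.single j 1 - x j • Pi.single i 1 : Fin (n + 1) → S) l *
        signedMinors A l = x i * signedMinors A j - x j * signedMinors A i := by
      simp [sub_mul, Finset.sum_sub_distrib, Pi.single_apply]
    rw [h'] at h
    exact sub_eq_zero.mp h.symm
  · ext l
    refine Fin.cases ?_ (fun l => ?_) l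
    · simp [Matrix.mulVec, dotProduct, sub_mul, Finset.sum_sub_distrib,
        Pi.single_apply, mul_comm (x i) (x j)]
    · simpa [Matrix.mulVec, dotProduct] using hA l

/-- Independent rows extend to a basis by one more row; the resulting nonzero determinant is a
combination of the minors. -/
lemma exists_signedMinors_ne_zero {K : Type*} [Field K] {n : ℕ} (A : Fin n → Fin (n + 1) → K)
    (hA : LinearIndependent K A) : ∃ j, signedMinors A j ≠ 0 := by
  by_contra! h
  have hlt : Submodule.span K (Set.range A) < ⊤ := by
    refine Submodule.lt_top_of_finrank_lt_finrank ?_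
    rw [finrank_span_eq_card hA]
    simp
  obtain ⟨v, -, hv⟩ := SetLike.exists_of_lt hlt
  have hli := linearIndependent_finCons.mpr ⟨hA, hv⟩
  have hu := (Matrix.isUnit_iff_isUnit_det _).mp ((Matrix.linearIndependent_rows_iff_isUnit
    (A := Matrix.of (Fin.cons v A : Fin (n + 1) → Fin (n + 1) → K))).mp hli)
  rw [det_cons_eq_sum] at hu
  simp [h] at hu

lemma isHomogeneous_signedMinors {k τ : Type*} [CommRing k] {n : ℕ}
    (A : Fin n → Fin (n + 1) → MvPolynomial τ k) (q : Fin n → ℕ)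
    (hA : ∀ i l, (A i l).IsHomogeneous (q i)) (j : Fin (n + 1)) :
    (signedMinors A j).IsHomogeneous (∑ i, q i) := by
  -- Transposing makes the product in the Leibniz formula run over rows, whose degrees are `0` for
  -- the unit row and then the `q i`.
  rw [signedMinors, ← Matrix.det_transpose, Matrix.det_apply]
  refine IsHomogeneous.sum _ _ _ fun s _ => ?_
  rw [Units.smul_def, zsmul_eq_mul, ← map_intCast (C : k →+* MvPolynomial τ k)]
  refine IsHomogeneous.C_mul ?_ _
  have := IsHomogeneous.prod (Finset.univ : Finset (Fin (n + 1)))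
    (fun i => (Matrix.of (Fin.cons (Pi.single j 1) A :
      Fin (n + 1) → Fin (n + 1) → MvPolynomial τ k)).transpose (s i) i)
    (Fin.cons 0 q : Fin (n + 1) → ℕ) (fun i _ => ?_)
  · simpa [Fin.sum_univ_succ] using this
  · refine Fin.cases ?_ (fun i => ?_) i
    · by_cases h : s 0 = j
      · simpa [h] using isHomogeneous_one τ k
      · simpa [h, Pi.single_apply] using isHomogeneous_zero τ k 0
    · simpa using hA i _

end Determinants

section Rows

variable {k : Type*} [Field k] {n m : ℕ}

/-- The homogeneous linear relations with coefficients in `k[Y]` which hold for the variables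
`X i` after the substitution `Y j ↦ f j`. -/
def linearRelations (f : Fin (m + 1) → MvPolynomial (Fin (n + 1)) k) :
    Set (Fin (n + 1) → MvPolynomial (Fin (m + 1)) k) :=
  {b | (∃ q, ∀ i, (b i).IsHomogeneous q) ∧ ∑ i, aeval f (b i) * X i = 0}

lemma eval_eq_zero_of_mem_reesIdeal (f : Fin (m + 1) → MvPolynomial (Fin (n + 1)) k)
    {P : MvPolynomial (Fin (m + 1)) (MvPolynomial (Fin (n + 1)) k)} (hP : P ∈ reesIdeal f) :
    eval f P = 0 := by
  -- Setting `t = 1` in the Rees algebra turns `Y j ↦ f j * t` into evaluation at `f`.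
  have h : (Polynomial.evalRingHom 1).comp (((reesAlgebra (Ideal.span (Set.range f))).val :
      _ →+* Polynomial (MvPolynomial (Fin (n + 1)) k)).comp
        (reesPresentation f : _ →+* reesAlgebra (Ideal.span (Set.range f)))) = eval f := by
    refine MvPolynomial.ringHom_ext (fun r => ?_) fun j => ?_
    · simp [reesPresentation]
    · simp [reesPresentation]
  have h0 : reesPresentation f P = 0 := hP
  rw [← h]
  simp [h0]

/-- A form of degree one is the linear form on its coefficients. -/
lemma eq_sum_of_isHomogeneous_one {σ R : Type*} [Fintype σ] [CommRing R]
    {p : MvPolynomial σ R} (hp : p.IsHomogeneous 1) :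
    p = ∑ i, C (p.coeff (Finsupp.single i 1)) * X i := by
  classical
  ext α
  simp only [coeff_sum, coeff_C_mul, coeff_X]
  by_cases h : ∃ i, α = Finsupp.single i 1
  · obtain ⟨i, rfl⟩ := h
    simp [Finsupp.single_left_inj]
  · rw [Finset.sum_eq_zero]
    · by_contra hne
      exact h (by
        have := hp hne
        rw [show Finsupp.weight (1 : σ → ℕ) α = α.degree from
          (congrArg (· α) Finsupp.degree_eq_weight_one).symm] at this
        exact (Finsupp.sum_eq_one_iff α).mp this)
    · intro i _
      rw [if_neg (fun hi => h ⟨i, hi.symm⟩), mul_zero]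

/-- A polynomial in `Y` whose coefficients are linear forms in `X`, as a linear form in `X` with
coefficients polynomials in `Y`. -/
lemma exists_eq_sum_of_coeff_isHomogeneous_one {σ τ R : Type*} [Fintype σ] [CommRing R]
    {P : MvPolynomial τ (MvPolynomial σ R)} {q : ℕ} (hP : P.IsHomogeneous q)
    (hP1 : ∀ α, (P.coeff α).IsHomogeneous 1) :
    ∃ b : σ → MvPolynomial τ R, (∀ i, (b i).IsHomogeneous q) ∧
      P = ∑ i, C (X i) * MvPolynomial.map C (b i) := by
  refine ⟨fun i => ∑ α ∈ P.support, monomial α ((P.coeff α).coeff (Finsupp.single i 1)),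
    fun i => ?_, ?_⟩
  · refine IsHomogeneous.sum _ _ _ fun α hα => isHomogeneous_monomial _ ?_
    rw [Finsupp.degree_eq_weight_one]
    exact hP (mem_support_iff.mp hα)
  · conv_lhs => rw [P.as_sum]
    simp only [map_sum, map_monomial, C_mul_monomial, Finset.mul_sum]
    rw [Finset.sum_comm]
    refine Finset.sum_congr rfl fun α _ => ?_
    rw [← map_sum]
    congr 1
    conv_lhs => rw [eq_sum_of_isHomogeneous_one (hP1 α)]
    exact Finset.sum_congr rfl fun i _ => mul_comm _ _

lemma toImageRing_C_X (f : Fin (m + 1) → MvPolynomial (Fin (n + 1)) k) (i : Fin (n + 1)) :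
    toImageRing f (C (X i)) = X i := by
  simp [toImageRing]

lemma toImageRing_map_C (f : Fin (m + 1) → MvPolynomial (Fin (n + 1)) k)
    (b : MvPolynomial (Fin (m + 1)) k) :
    toImageRing f (MvPolynomial.map C b) = C (Ideal.Quotient.mk (imageIdeal f) b) := by
  have h : (toImageRing f).comp (MvPolynomial.map C) =
      (C : _ →+* MvPolynomial (Fin (n + 1)) (ImageRing f)).comp
        (Ideal.Quotient.mk (imageIdeal f)) := by
    refine MvPolynomial.ringHom_ext (fun r => ?_) fun j => ?_
    · simp [toImageRing]
      rfl
    · simp [toImageRing]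
  exact RingHom.congr_fun h b

lemma semilinearIdealOverImage_le (f : Fin (m + 1) → MvPolynomial (Fin (n + 1)) k) :
    semilinearIdealOverImage f ≤ Ideal.span (linearForm ''
      ((fun b i => Ideal.Quotient.mk (imageIdeal f) (b i)) '' linearRelations f)) := by
  rw [semilinearIdealOverImage, semilinearIdeal, Ideal.map_span, Ideal.span_le]
  rintro _ ⟨P, hP, rfl⟩
  obtain ⟨q, hPJ, hPq, hP1⟩ := Set.mem_iUnion.mp hP
  obtain ⟨b, hb, rfl⟩ := exists_eq_sum_of_coeff_isHomogeneous_one hPq hP1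
  refine Ideal.subset_span ⟨_, ⟨b, ⟨⟨q, hb⟩, ?_⟩, rfl⟩, ?_⟩
  · have := eval_eq_zero_of_mem_reesIdeal f hPJ
    simpa only [map_sum, map_mul, eval_C, eval_map, aeval_def, algebraMap_eq, mul_comm]
      using this
  · simp [linearForm_apply, toImageRing_C_X, toImageRing_map_C, mul_comm]

instance imageIdeal_isPrime (f : Fin (m + 1) → MvPolynomial (Fin (n + 1)) k) :
    (imageIdeal f).IsPrime :=
  RingHom.ker_isPrime _

lemma substitute_mk (f : Fin (m + 1) → MvPolynomial (Fin (n + 1)) k)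
    (b : MvPolynomial (Fin (m + 1)) k) :
    substitute f (Ideal.Quotient.mk (imageIdeal f) b) = aeval f b := rfl

lemma substitute_injective (f : Fin (m + 1) → MvPolynomial (Fin (n + 1)) k) :
    Function.Injective (substitute f) :=
  Ideal.kerLiftAlg_injective _

/-- A tuple of forms over `k[Y]` of the same degree, not all vanishing on the image, whose
substitution is proportional to the variables, gives an inverse rational map. -/
lemma isBirationalOntoImage_of_proportional {d : ℕ}
    (f : Fin (m + 1) → MvPolynomial (Fin (n + 1)) k)
    (hf : IsRationalDatum (homogeneousSubmodule (Fin (n + 1)) k) d f)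
    {e : ℕ} (he : 1 ≤ e) (g : Fin (n + 1) → MvPolynomial (Fin (m + 1)) k)
    (hg : ∀ i, (g i).IsHomogeneous e) (hne : ∃ i, aeval f (g i) ≠ 0)
    (hprop : ∀ i j, X i * aeval f (g j) = X j * aeval f (g i)) :
    IsBirationalOntoImage f := by
  obtain ⟨i₀, hi₀⟩ := hne
  have h0 : aeval f (g 0) ≠ 0 := by
    intro h
    have := hprop 0 i₀
    rw [h, mul_zero, mul_eq_zero] at this
    exact this.elim (X_ne_zero 0) hi₀
  refine ⟨e, fun i => Ideal.Quotient.mk (imageIdeal f) (g i), ⟨he, fun i => ⟨g i, hg i, rfl⟩,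
    inferInstance, fun P hP hle => ?_⟩, aeval f (g 0), ?_, X 0, ?_,
    ⟨d * e, ?_⟩, ⟨1, isHomogeneous_X k 0⟩, fun j => ?_⟩
  · rw [IsDomain.minimalPrimes_eq_singleton_bot, Set.mem_singleton_iff] at hP
    subst hP
    have : Ideal.Quotient.mk (imageIdeal f) (g i₀) = 0 := hle (Ideal.subset_span ⟨i₀, rfl⟩)
    exact hi₀ (by rw [← substitute_mk, this, map_zero])
  · exact mem_nonZeroDivisors_of_ne_zero h0
  · exact mem_nonZeroDivisors_of_ne_zero (X_ne_zero 0)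
  · exact (hg 0).aeval f hf.mem_degree
  · exact (mul_comm _ _).trans (hprop 0 j).symm

lemma exists_ne_zero {d : ℕ} (f : Fin (m + 1) → MvPolynomial (Fin (n + 1)) k)
    (hf : IsRationalDatum (homogeneousSubmodule (Fin (n + 1)) k) d f) : ∃ j, f j ≠ 0 := by
  by_contra! h
  refine hf.not_le_minimalPrime ⊥ (by simp [IsDomain.minimalPrimes_eq_singleton_bot]) ?_
  rw [Ideal.span_le]
  rintro _ ⟨j, rfl⟩
  simp [h j]

end Rows

end RatMap

theorem mainTheorem9 {k : Type*} [Field k] (n m d : ℕ)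
    (f : Fin (m + 1) → MvPolynomial (Fin (n + 1)) k)
    (hf : RatMap.IsRationalDatum (MvPolynomial.homogeneousSubmodule (Fin (n + 1)) k) d f)
    (hcodim : (n : ℕ∞) ≤ Ideal.height (R := MvPolynomial (Fin (n + 1)) (RatMap.ImageRing f))
      (RatMap.semilinearIdealOverImage f)) :
    RatMap.IsBirationalOntoImage f := by
  open RatMap MvPolynomial in
  set ψ := algebraMap (ImageRing f) (FractionRing (ImageRing f))
  have hψ : Function.Injective ψ := IsFractionRing.injective _ _
  have hrank := hcodim.trans ((Ideal.height_mono (semilinearIdealOverImage_le f)).trans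
    (height_span_linearForm_le _))
  obtain ⟨v, hv, -, hli⟩ := Submodule.exists_fun_fin_finrank_span_eq
    (FractionRing (ImageRing f)) ((fun a i => ψ (a i)) ''
      ((fun b i => Ideal.Quotient.mk (imageIdeal f) (b i)) '' linearRelations f))
  have hv' (i : Fin n) := hv (Fin.castLE (by exact_mod_cast hrank) i)
  have hli' := hli.comp _ (Fin.castLE_injective (by exact_mod_cast hrank : n ≤ _))
  choose a ha hav using hv'
  choose b hb hba using ha
  choose q hq using fun i => (hb i).1
  obtain ⟨j₀, hj₀⟩ := exists_ne_zero f hf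
  have hv_eq (i : Fin n) (l : Fin (n + 1)) :
      ψ (Ideal.Quotient.mk (imageIdeal f) (b i l)) = v (Fin.castLE (by exact_mod_cast hrank) i) l := by
    rw [← hav, ← hba]
  obtain ⟨j, hj⟩ := exists_signedMinors_ne_zero _ hli'
  -- Nonvanishing passes from `Frac S` to `k[X]` because `S` embeds in `k[X]` by substitution.
  have hj' : aeval f (signedMinors b j) ≠ 0 := by
    intro h
    apply hj
    have h1 : Ideal.Quotient.mk (imageIdeal f) (signedMinors b j) = 0 :=
      substitute_injective f (by rw [substitute_mk, h, map_zero])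
    have h2 := map_signedMinors (ψ.comp (Ideal.Quotient.mk (imageIdeal f))) b j
    rw [RingHom.comp_apply, h1, map_zero] at h2
    rw [h2]
    congr 1
    ext i l
    exact (hv_eq i l).symm
  -- The minors may have degree `0`; the common factor `X j₀`, with `f j₀ ≠ 0`, makes the degree
  -- positive.
  refine isBirationalOntoImage_of_proportional f hf (e := 1 + ∑ i, q i) (by omega)
    (fun i => X j₀ * signedMinors b i)
    (fun i => (isHomogeneous_X k j₀).mul (isHomogeneous_signedMinors b q hq i))
    ⟨j, by simpa using ⟨hj₀, hj'⟩⟩ fun i l => ?_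
  have := mul_signedMinors_comm (fun i l => aeval f (b i l)) (x := X)
    (fun h => X_ne_zero (R := k) (0 : Fin (n + 1)) (congrFun h 0)) (fun i => (hb i).2) i l
  have hmap (j) : aeval f (signedMinors b j) = signedMinors (fun i l => aeval f (b i l)) j :=
    map_signedMinors (aeval f : MvPolynomial (Fin (m + 1)) k →ₐ[k] _).toRingHom b j
  simp only [map_mul, aeval_X, hmap]
  linear_combination f j₀ * this
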